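/- **Conventions.** A generalized topology in a set $X$ is a collection $\mathrm{Cov}_X$ of families of subsets of $X$ such that, with $\mathrm{Op}_X=\bigcup \mathrm{Cov}_X$ (the *open* sets): $\emptyset,X\in\mathrm{Op}_X$ and $\mathrm{Op}_X$ is closed under binary unions and intersections; every finite family of open sets is in $\mathrm{Cov}_X$; $\bigcup\mathcal U\in\mathrm{Op}_X$ for $\mathcal U\in\mathrm{Cov}_X$; if $\mathcal U\in\mathrm{Cov}_X$ and $V\in\mathrm{Op}_X$, then $\{V\cap U:U\in\mathcal U\}\in\mathrm{Cov}_X$; if $\mathcal U\in \mathrm{Cov}_X$ and, for each $U\in\mathcal U$, $\mathcal V_U\in\mathrm{Cov}_X$ with $\bigcup\mathcal V_U=U$, then $\bigcup_{U\in\mathcal U}\mathcal V_U\in\mathrm{Cov}_X$; if $\mathcal U\subseteq\mathrm{Op}_X$, $\mathcal V\in\mathrm{Cov}_X$, $\bigcup\mathcal U=\bigcup\mathcal V$ and every $V\in\mathcal V$ is contained in some $U\in\mathcal U$, then $\mathcal U\in\mathrm{Cov}_X$; if $\mathcal U\in\mathrm{Cov}_X$, $W\subseteq\bigcup\mathcal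 U$ and $W\cap U\in\mathrm{Op}_X$ for all $U\in\mathcal U$, then $W\in\mathrm{Op}_X$. The pair $(X,\mathrm{Cov}_X)$ is a *gts*, also denoted $X$. Put $\mathrm{Cl}_X=\{A\subseteq X: X\setminus A\in\mathrm{Op}_X\}$ and let $X_{top}$ be $X$ with the topology generated by $\mathrm{Op}_X$. A set or a gts is *topologically compact* (*locally compact*) if it is so in $X_{top}$; a gts is *weakly Hausdorff* if $X_{top}$ is Hausdorff; it is *weakly normal* if any two disjoint sets $A_1,A_2$, each of them a singleton or a member of $\mathrm{Cl}_X$, are contained in disjoint members of $\mathrm{Op}_X$; it is *small* if $\mathrm{Cov}_X$ consists of all families $\mathcal U\subseteq\mathrm{Op}_X$ that have a finite subfamily with the same union. For a family $\mathcal U$ and a set $Y$ put $\mathcal U\cap_1 Y=\{U\cap Y:U\in\mathcal U\}$, and for a collection $\mathcal A$ of families put $\mathcal A\cap_2Y=\{\mathcal U\cap_1 Y:\mathcal U\in\mathcal A\}$. Let $\langle\mathcal A\rangle_Y$ be the smallest generalized topology in $Y$ containing $\mathcal A$. A set $Y\subseteq Z$ of a gts $Z$ is *strict* if $\langle\mathrm{Cov}_Z\cap_2Y\rangle_Y=\mathrm{Cov}_Z\cap_2Y$;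 a gts $(Y,\mathrm{Cov}_Y)$ is a *strict subspace* of $Z$ if moreover $\mathrm{Cov}_Y=\langle\mathrm{Cov}_Z\cap_2Y\rangle_Y$. A map $f:X\to Z$ between gtses is a *strict embedding* if it is injective, $f^{-1}(\mathcal V)=\{f^{-1}(V):V\in\mathcal V\}\in\mathrm{Cov}_X$ for each $\mathcal V\in\mathrm{Cov}_Z$, and, for each $\mathcal U\in\mathrm{Cov}_X$, the family $\{f(U):U\in\mathcal U\}$ belongs to $\mathrm{Cov}_Z\cap_2f(X)$. A *strict compactification* of $X$ is a topologically compact gts $Z$ with a strict embedding $f:X\to Z$ such that $f(X)$ is dense in $Z_{top}$. If $X$ is topologically locally compact, write $A\sim B$ for $A,B\in\mathrm{Cl}_X$ if every member of $\mathrm{Cl}_X$ contained in the symmetric difference $A\bigtriangleup B$ is topologically compact. This is an equivalence relation; let $[A]^X$ be the class of $A$ and let $L(\mathrm{Cl}_X)$ be the set of the classes, which is a lattice with $[A]^X\wedge[B]^X=[A\cap B]^X$ and $[A]^X\vee[B]^X=[A\cup B]^X$. The lattice operations of $\mathrm{Cl}_K$ are $\cap$ and $\cup$. **Theorem.** Let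 $X$ be a weakly normal gts that is topologically non-compact and topologically locally compact, let $K$ be a weakly Hausdorff topologically compact gts, and let $\psi:\mathrm{Cl}_K\to L(\mathrm{Cl}_X)$ be a lattice isomorphism. On the disjoint union $X\cup K$ let $\tau$ be the topology generated by the complements of the sets $A\cup\psi^{-1}([A]^X)$, $A\in\mathrm{Cl}_X$, and put $$\mathrm{Op}^s=\{U\in\tau: U\cap X\in\mathrm{Op}_X,\ U\cap K\in\mathrm{Op}_K\},$$ $$\mathrm{Cov}^s=\{\mathcal U\subseteq\mathrm{Op}^s:\ \mathcal U\cap_1 X\in\mathrm{Cov}_X,\ \mathcal U\cap_1 K\in\mathrm{Cov}_K\}.$$ Assume that at least one of the following holds: (i) $\mathrm{Cov}_X$ and $\mathrm{Cov}_K$ are $\psi$-correlated, that is, $\mathrm{Cov}_K=\{\{K\setminus\psi^{-1}([X\setminus U]^X):U\in\mathcal U\}:\mathcal U\in\mathrm{Cov}_X\}$; (ii) both $X$ and $K$ are small. Then $\mathrm{Cov}^s$ is a generalized topology in $X\cup K$ with $\bigcup\mathrm{Cov}^s=\mathrm{Op}^s$, the gts $\alpha^s_\psi X=(X\cup K,\mathrm{Op}^s,\mathrm{Cov}^s)$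 is weakly Hausdorff and, with the inclusion of $X$, it is a strict compactification of $X$; moreover, the gts $K$ is a strict subspace of $\alpha^s_\psi X$. -/

import Mathlib

universe u v

open scoped Topology

/-- `Cov` is a generalized topology in `X` in the sense of Delfs and Knebusch; the open sets are the
members of `⋃₀ Cov`, and the members of `Cov` are the admissible open families. -/
structure IsGenTopology {X : Type u} (Cov : Set (Set (Set X))) : Prop where
  empty_open : ∅ ∈ ⋃₀ Cov
  univ_open : Set.univ ∈ ⋃₀ Cov
  inter_open : ∀ U ∈ ⋃₀ Cov, ∀ V ∈ ⋃₀ Cov, U ∩ V ∈ ⋃₀ Cov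
  union_open : ∀ U ∈ ⋃₀ Cov, ∀ V ∈ ⋃₀ Cov, U ∪ V ∈ ⋃₀ Cov
  finiteness : ∀ 𝒰 : Set (Set X), 𝒰 ⊆ ⋃₀ Cov → 𝒰.Finite → 𝒰 ∈ Cov
  sUnion_open : ∀ 𝒰 ∈ Cov, ⋃₀ 𝒰 ∈ ⋃₀ Cov
  stability : ∀ 𝒰 ∈ Cov, ∀ V ∈ ⋃₀ Cov, (fun U => V ∩ U) '' 𝒰 ∈ Cov
  transitivity : ∀ 𝒰 ∈ Cov, ∀ Φ : Set X → Set (Set X),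
    (∀ U ∈ 𝒰, Φ U ∈ Cov ∧ ⋃₀ Φ U = U) → (⋃ U ∈ 𝒰, Φ U) ∈ Cov
  saturation : ∀ 𝒰 : Set (Set X), 𝒰 ⊆ ⋃₀ Cov → ∀ 𝒱 ∈ Cov, ⋃₀ 𝒰 = ⋃₀ 𝒱 →
    (∀ V ∈ 𝒱, ∃ U ∈ 𝒰, V ⊆ U) → 𝒰 ∈ Cov
  regularity : ∀ 𝒰 ∈ Cov, ∀ W : Set X, W ⊆ ⋃₀ 𝒰 → (∀ U ∈ 𝒰, W ∩ U ∈ ⋃₀ Cov) → W ∈ ⋃₀ Cov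

/-- A generalized topological space (gts) with underlying set `X`. -/
structure GTS (X : Type u) where
  Cov : Set (Set (Set X))
  isGenTopology : IsGenTopology Cov

/-- The smallest generalized topology `⟨𝒜⟩` containing `𝒜`: a family belongs to it iff it belongs
to every generalized topology that contains `𝒜`. -/
def genTopologyGenerated {X : Type u} (𝒜 : Set (Set (Set X))) : Set (Set (Set X)) :=
  {𝒰 | ∀ Cov, IsGenTopology Cov → 𝒜 ⊆ Cov → 𝒰 ∈ Cov}

/-- The collection `{ {U ∩ Y : U ∈ 𝒰} : 𝒰 ∈ 𝒜 }`, as a collection of families of subsets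
of `Y`. -/
def traceOn {X : Type u} (𝒜 : Set (Set (Set X))) (Y : Set X) : Set (Set (Set Y)) :=
  {𝒲 | ∃ 𝒰 ∈ 𝒜, 𝒲 = (fun U => (Subtype.val : Y → X) ⁻¹' U) '' 𝒰}

/-- The collection `f(𝒜) = { {f(U) : U ∈ 𝒰} : 𝒰 ∈ 𝒜 }`, as a collection of families of
subsets of the image of `f`. -/
def imageOn {X : Type u} {Y : Type v} (f : X → Y) (𝒜 : Set (Set (Set X))) :
    Set (Set (Set (Set.range f))) :=
  {𝒲 | ∃ 𝒰 ∈ 𝒜, 𝒲 = (fun U => Set.rangeFactorization f '' U) '' 𝒰}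

namespace GTS

variable {X : Type u} {Y : Type v}

/-- The open sets of a gts. -/
def Op (T : GTS X) : Set (Set X) := ⋃₀ T.Cov

/-- The closed sets of a gts. -/
def Cl (T : GTS X) : Set (Set X) := {A | Aᶜ ∈ T.Op}

/-- The topology of the topologization, generated by the open sets. -/
@[reducible] def top (T : GTS X) : TopologicalSpace X := TopologicalSpace.generateFrom T.Op

/-- The essentially finite families of members of `𝒪`. -/
def EssFin (𝒪 : Set (Set X)) : Set (Set (Set X)) :=
  {𝒰 | 𝒰 ⊆ 𝒪 ∧ ∃ 𝒱 ⊆ 𝒰, 𝒱.Finite ∧ ⋃₀ 𝒰 = ⋃₀ 𝒱}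

def IsSmall (T : GTS X) : Prop := T.Cov = EssFin T.Op

def WeaklyNormal (T : GTS X) : Prop :=
  ∀ A₁ A₂ : Set X, ((∃ x, A₁ = {x}) ∨ A₁ ∈ T.Cl) → ((∃ x, A₂ = {x}) ∨ A₂ ∈ T.Cl) →
    Disjoint A₁ A₂ →
    ∃ W₁ ∈ T.Op, ∃ W₂ ∈ T.Op, Disjoint W₁ W₂ ∧ A₁ ⊆ W₁ ∧ A₂ ⊆ W₂

def WeaklyHausdorff (T : GTS X) : Prop := @T2Space X T.top

def TopCompact (T : GTS X) : Prop := @CompactSpace X T.top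

def TopLocallyCompact (T : GTS X) : Prop := @LocallyCompactSpace X T.top

/-- `A` is a topologically compact set in `X`. -/
def TopCompactSet (T : GTS X) (A : Set X) : Prop := @IsCompact X T.top A

/-- `f⁻¹(𝒱)` is admissible for every admissible `𝒱`. -/
def StrictlyContinuous (T : GTS X) (S : GTS Y) (f : X → Y) : Prop :=
  ∀ 𝒱 ∈ S.Cov, (fun V => f ⁻¹' V) '' 𝒱 ∈ T.Cov

/-- The generalized topology of the subspace `Z` of a gts. -/
def subspaceCov (T : GTS X) (Z : Set X) : Set (Set (Set Z)) :=
  genTopologyGenerated (traceOn T.Cov Z)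

/-- The set `Z` is strict in the gts. -/
def IsStrictSet (T : GTS X) (Z : Set X) : Prop :=
  genTopologyGenerated (traceOn T.Cov Z) = traceOn T.Cov Z

structure IsEmbedding (T : GTS X) (S : GTS Y) (f : X → Y) : Prop where
  strictlyContinuous : T.StrictlyContinuous S f
  injective : Function.Injective f
  image_subset : imageOn f T.Cov ⊆ S.subspaceCov (Set.range f)

structure IsStrictEmbedding (T : GTS X) (S : GTS Y) (f : X → Y) : Prop
    extends IsEmbedding T S f where
  image_subset_trace : imageOn f T.Cov ⊆ traceOn S.Cov (Set.range f)

/-- The pair `(S, f)` is a strict compactification of the gts `T`. -/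
structure IsStrictCompactification (T : GTS X) (S : GTS Y) (f : X → Y) : Prop where
  topCompact : S.TopCompact
  strictEmbedding : T.IsStrictEmbedding S f
  dense : @Dense Y S.top (Set.range f)

/-- When `X` is identified with its image under the injection `f : X → Y`, the gts `T` on `X` is a
subspace of the gts `S` on `Y`, and this subspace is strict. -/
structure IsStrictSubspace (T : GTS X) (S : GTS Y) (f : X → Y) : Prop where
  injective : Function.Injective f
  strict : S.IsStrictSet (Set.range f)
  subspace : imageOn f T.Cov = S.subspaceCov (Set.range f)

/-- The lattice `Cl_X` of closed sets, ordered by inclusion, with the operations `∩` and `∪`. -/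
def closedLattice (T : GTS X) : Sublattice (Set X) where
  carrier := T.Cl
  supClosed' := by
    intro A hA B hB
    have h := T.isGenTopology.inter_open _ hA _ hB
    rwa [← Set.compl_union] at h
  infClosed' := by
    intro A hA B hB
    have h := T.isGenTopology.union_open _ hA _ hB
    rwa [← Set.compl_inter] at h

/-- `A ∼ B`: the symmetric difference of `A` and `B` contains no topologically non-compact closed
set. -/
def Sim (T : GTS X) (A B : T.closedLattice) : Prop :=
  ∀ D ∈ T.Cl, D ⊆ symmDiff (A : Set X) (B : Set X) → T.TopCompactSet D

theorem inter_mem_Cl (T : GTS X) {A B : Set X} (hA : A ∈ T.Cl) (hB : B ∈ T.Cl) : A ∩ B ∈ T.Cl :=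
  T.closedLattice.infClosed' hA hB

theorem union_mem_Cl (T : GTS X) {A B : Set X} (hA : A ∈ T.Cl) (hB : B ∈ T.Cl) : A ∪ B ∈ T.Cl :=
  T.closedLattice.supClosed' hA hB

theorem isClosed_of_mem_Cl (T : GTS X) {A : Set X} (hA : A ∈ T.Cl) : IsClosed[T.top] A :=
  @IsClosed.mk X T.top A (TopologicalSpace.isOpen_generateFrom_of_mem hA)

theorem isTopologicalBasis_Op (T : GTS X) :
    @TopologicalSpace.IsTopologicalBasis X T.top T.Op := by
  let _ := T.top
  have h := TopologicalSpace.isTopologicalBasis_of_subbasis_of_inter (r := T.Op) rfl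
    (fun U hU V hV => T.isGenTopology.inter_open U hU V hV)
  rwa [Set.insert_eq_of_mem (show Set.univ ∈ T.Op from T.isGenTopology.univ_open)] at h

/-- If `D ∩ P` is topologically compact and every closed subset of `D \ P` is topologically compact,
then the closed set `D` is topologically compact. -/
theorem topCompactSet_of_inter (T : GTS X) (hlc : T.TopLocallyCompact) {D P : Set X}
    (hD : D ∈ T.Cl) (hDP : T.TopCompactSet (D ∩ P))
    (h : ∀ E ∈ T.Cl, E ⊆ D \ P → T.TopCompactSet E) : T.TopCompactSet D := by
  let _ := T.top
  have _ : LocallyCompactSpace X := hlc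
  obtain ⟨U, hU, N, hN, hUN, hPU⟩ : ∃ U ∈ T.Op, ∃ N : Set X, IsCompact N ∧ U ⊆ N ∧ D ∩ P ⊆ U := by
    refine IsCompact.induction_on (s := D ∩ P)
      (p := fun s => ∃ U ∈ T.Op, ∃ N : Set X, IsCompact N ∧ U ⊆ N ∧ s ⊆ U) hDP ?_ ?_ ?_ ?_
    · exact ⟨∅, T.isGenTopology.empty_open, ∅, isCompact_empty, subset_rfl, subset_rfl⟩
    · rintro s t hst ⟨U, hU, N, hN, hUN, htU⟩
      exact ⟨U, hU, N, hN, hUN, hst.trans htU⟩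
    · rintro s t ⟨U, hU, N, hN, hUN, hs⟩ ⟨V, hV, M, hM, hVM, ht⟩
      exact ⟨U ∪ V, T.isGenTopology.union_open _ hU _ hV, N ∪ M, hN.union hM,
        Set.union_subset_union hUN hVM, Set.union_subset_union hs ht⟩
    · intro x _
      obtain ⟨N, hN, hxN⟩ := exists_compact_mem_nhds x
      obtain ⟨U, hU, hxU, hUN⟩ := T.isTopologicalBasis_Op.mem_nhds_iff.1 hxN
      exact ⟨U, mem_nhdsWithin_of_mem_nhds (T.isTopologicalBasis_Op.mem_nhds hU hxU),
        U, hU, N, hN, hUN, subset_rfl⟩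
  have hUc : Uᶜ ∈ T.Cl := by simpa [Cl] using hU
  have h1 : IsCompact (D ∩ Uᶜ) := h _ (T.inter_mem_Cl hD hUc)
    (fun x hx => ⟨hx.1, fun hxP => hx.2 (hPU ⟨hx.1, hxP⟩)⟩)
  have h2 : IsCompact (D ∩ N) := hN.inter_left (T.isClosed_of_mem_Cl hD)
  have h3 : D = (D ∩ Uᶜ) ∪ (D ∩ N) := by
    ext x
    have := @hUN x
    simp only [Set.mem_union, Set.mem_inter_iff, Set.mem_compl_iff]
    tauto
  change IsCompact D
  rw [h3]
  exact h1.union h2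

theorem sim_iff (T : GTS X) (A B : T.closedLattice) :
    T.Sim A B ↔ (∀ D ∈ T.Cl, D ⊆ (A : Set X) \ B → T.TopCompactSet D) ∧
      (∀ D ∈ T.Cl, D ⊆ (B : Set X) \ A → T.TopCompactSet D) := by
  constructor
  · intro h
    exact ⟨fun D hD hs => h D hD (hs.trans Set.subset_union_left),
      fun D hD hs => h D hD (hs.trans Set.subset_union_right)⟩
  · rintro ⟨h1, h2⟩ D hD hs
    have k1 := h1 (D ∩ A) (T.inter_mem_Cl hD A.2) (by
      rintro x ⟨hx, hxA⟩
      rcases hs hx with h | h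
      · exact h
      · exact absurd hxA h.2)
    have k2 := h2 (D ∩ B) (T.inter_mem_Cl hD B.2) (by
      rintro x ⟨hx, hxB⟩
      rcases hs hx with h | h
      · exact absurd hxB h.2
      · exact h)
    have h3 : D = (D ∩ A) ∪ (D ∩ B) := by
      ext x
      constructor
      · intro hx
        rcases hs hx with h | h
        · exact Or.inl ⟨hx, h.1⟩
        · exact Or.inr ⟨hx, h.1⟩
      · rintro (h | h) <;> exact h.1
    let _ := T.top
    change IsCompact D
    rw [h3]
    exact IsCompact.union k1 k2

theorem sim_trans_aux (T : GTS X) (hlc : T.TopLocallyCompact) {A B C : T.closedLattice}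
    (h1 : ∀ D ∈ T.Cl, D ⊆ (A : Set X) \ B → T.TopCompactSet D)
    (h2 : ∀ D ∈ T.Cl, D ⊆ (B : Set X) \ C → T.TopCompactSet D) :
    ∀ D ∈ T.Cl, D ⊆ (A : Set X) \ C → T.TopCompactSet D := fun _ hD hs =>
  T.topCompactSet_of_inter hlc (P := B) hD
    (h2 _ (T.inter_mem_Cl hD B.2) fun _ hx => ⟨hx.2, (hs hx.1).2⟩)
    fun E hE hEs => h1 E hE fun _ hx => ⟨(hs (hEs hx).1).1, (hEs hx).2⟩

/-- In a topologically locally compact gts, `∼` is an equivalence relation on `Cl_X`. -/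
def simSetoid (T : GTS X) (hlc : T.TopLocallyCompact) : Setoid T.closedLattice where
  r := T.Sim
  iseqv := by
    refine ⟨fun A => ?_, fun {A B} h => ?_, fun {A B C} h1 h2 => ?_⟩
    · rw [sim_iff]
      refine ⟨fun D hD hs => ?_, fun D hD hs => ?_⟩ <;>
      · rw [sdiff_self, Set.bot_eq_empty, Set.subset_empty_iff] at hs
        subst hs
        exact @isCompact_empty X T.top
    · rw [sim_iff] at h ⊢
      exact h.symm
    · rw [sim_iff] at h1 h2 ⊢
      exact ⟨T.sim_trans_aux hlc h1.1 h2.1, T.sim_trans_aux hlc h2.2 h1.2⟩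

theorem sim_sup_aux (T : GTS X) {A A' B B' : T.closedLattice}
    (h1 : ∀ D ∈ T.Cl, D ⊆ (A : Set X) \ A' → T.TopCompactSet D)
    (h2 : ∀ D ∈ T.Cl, D ⊆ (B : Set X) \ B' → T.TopCompactSet D) :
    ∀ D ∈ T.Cl, D ⊆ ((A ⊔ B : T.closedLattice) : Set X) \ (A' ⊔ B' : T.closedLattice) →
      T.TopCompactSet D := by
  intro D hD hs
  have k1 := h1 (D ∩ A) (T.inter_mem_Cl hD A.2)
    fun x hx => ⟨hx.2, fun h => (hs hx.1).2 (Or.inl h)⟩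
  have k2 := h2 (D ∩ B) (T.inter_mem_Cl hD B.2)
    fun x hx => ⟨hx.2, fun h => (hs hx.1).2 (Or.inr h)⟩
  have h3 : D = (D ∩ A) ∪ (D ∩ B) := by
    ext x
    constructor
    · intro hx
      rcases (hs hx).1 with h | h
      · exact Or.inl ⟨hx, h⟩
      · exact Or.inr ⟨hx, h⟩
    · rintro (h | h) <;> exact h.1
  let _ := T.top
  change IsCompact D
  rw [h3]
  exact IsCompact.union k1 k2

theorem sim_inf_aux (T : GTS X) (hlc : T.TopLocallyCompact) {A A' B B' : T.closedLattice}
    (h1 : ∀ D ∈ T.Cl, D ⊆ (A : Set X) \ A' → T.TopCompactSet D)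
    (h2 : ∀ D ∈ T.Cl, D ⊆ (B : Set X) \ B' → T.TopCompactSet D) :
    ∀ D ∈ T.Cl, D ⊆ ((A ⊓ B : T.closedLattice) : Set X) \ (A' ⊓ B' : T.closedLattice) →
      T.TopCompactSet D := fun _ hD hs =>
  T.topCompactSet_of_inter hlc (P := A') hD
    (h2 _ (T.inter_mem_Cl hD A'.2) fun _ hx => ⟨(hs hx.1).1.2, fun h => (hs hx.1).2 ⟨hx.2, h⟩⟩)
    fun E hE hEs => h1 E hE fun _ hx => ⟨(hs (hEs hx).1).1.1, (hEs hx).2⟩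

/-- The quotient set `L(Cl_X)` of `Cl_X` by `∼`. -/
def LCl (T : GTS X) (hlc : T.TopLocallyCompact) : Type u := Quotient (T.simSetoid hlc)

/-- The class `[A]` of a closed set `A` in `L(Cl_X)`. -/
def cls (T : GTS X) (hlc : T.TopLocallyCompact) (A : T.closedLattice) : T.LCl hlc :=
  Quotient.mk (T.simSetoid hlc) A

section LatticeStructure

variable {T : GTS X} {hlc : T.TopLocallyCompact}

instance : Max (T.LCl hlc) where
  max := Quotient.map₂ (fun A B => A ⊔ B) (by
    intro A A' hA B B' hB
    have h1 := (T.sim_iff A A').1 hA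
    have h2 := (T.sim_iff B B').1 hB
    exact (T.sim_iff _ _).2 ⟨T.sim_sup_aux h1.1 h2.1, T.sim_sup_aux h1.2 h2.2⟩)

instance : Min (T.LCl hlc) where
  min := Quotient.map₂ (fun A B => A ⊓ B) (by
    intro A A' hA B B' hB
    have h1 := (T.sim_iff A A').1 hA
    have h2 := (T.sim_iff B B').1 hB
    exact (T.sim_iff _ _).2 ⟨T.sim_inf_aux hlc h1.1 h2.1, T.sim_inf_aux hlc h1.2 h2.2⟩)

theorem cls_surjective (a : T.LCl hlc) : ∃ A, T.cls hlc A = a := Quotient.exists_rep a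

theorem cls_sup (A B : T.closedLattice) : T.cls hlc A ⊔ T.cls hlc B = T.cls hlc (A ⊔ B) := rfl

theorem cls_inf (A B : T.closedLattice) : T.cls hlc A ⊓ T.cls hlc B = T.cls hlc (A ⊓ B) := rfl

/-- The lattice `L(Cl_X)`, with `[A] ⊓ [B] = [A ∩ B]` and `[A] ⊔ [B] = [A ∪ B]`. -/
instance : Lattice (T.LCl hlc) := Lattice.mk'
  (by
    intro a b
    obtain ⟨A, rfl⟩ := cls_surjective a
    obtain ⟨B, rfl⟩ := cls_surjective b
    simp only [cls_sup, sup_comm])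
  (by
    intro a b c
    obtain ⟨A, rfl⟩ := cls_surjective a
    obtain ⟨B, rfl⟩ := cls_surjective b
    obtain ⟨C, rfl⟩ := cls_surjective c
    simp only [cls_sup, sup_assoc])
  (by
    intro a b
    obtain ⟨A, rfl⟩ := cls_surjective a
    obtain ⟨B, rfl⟩ := cls_surjective b
    simp only [cls_inf, inf_comm])
  (by
    intro a b c
    obtain ⟨A, rfl⟩ := cls_surjective a
    obtain ⟨B, rfl⟩ := cls_surjective b
    obtain ⟨C, rfl⟩ := cls_surjective c
    simp only [cls_inf, inf_assoc])
  (by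
    intro a b
    obtain ⟨A, rfl⟩ := cls_surjective a
    obtain ⟨B, rfl⟩ := cls_surjective b
    simp only [cls_inf, cls_sup, sup_inf_self])
  (by
    intro a b
    obtain ⟨A, rfl⟩ := cls_surjective a
    obtain ⟨B, rfl⟩ := cls_surjective b
    simp only [cls_inf, cls_sup, inf_sup_self])

end LatticeStructure

section Construction

variable {K : Type v} {T : GTS X} {S : GTS K} {hlc : T.TopLocallyCompact}

/-- `Cl^w`: the sets `A ∪ ψ⁻¹([A])` in the disjoint union of `X` and `K`, for closed `A`. -/
def clW (ψ : S.closedLattice ≃o T.LCl hlc) : Set (Set (X ⊕ K)) :=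
  {F | ∃ A : T.closedLattice,
    F = Sum.inl '' (A : Set X) ∪ Sum.inr '' (ψ.symm (T.cls hlc A) : Set K)}

def opW (ψ : S.closedLattice ≃o T.LCl hlc) : Set (Set (X ⊕ K)) := {U | Uᶜ ∈ clW ψ}

/-- The topology on the disjoint union of `X` and `K` generated by `Op^w`. -/
@[reducible] def topW (ψ : S.closedLattice ≃o T.LCl hlc) : TopologicalSpace (X ⊕ K) :=
  TopologicalSpace.generateFrom (opW ψ)

/-- `Op^s`: the sets open for `topW` whose traces on `X` and on `K` are open. -/
def opS (ψ : S.closedLattice ≃o T.LCl hlc) : Set (Set (X ⊕ K)) :=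
  {U | IsOpen[topW ψ] U ∧ Sum.inl ⁻¹' U ∈ T.Op ∧ Sum.inr ⁻¹' U ∈ S.Op}

/-- `Cov^s`: the families of members of `Op^s` whose traces on `X` and on `K` are admissible. -/
def covS (ψ : S.closedLattice ≃o T.LCl hlc) : Set (Set (Set (X ⊕ K))) :=
  {𝒰 | 𝒰 ⊆ opS ψ ∧ (fun U => (Sum.inl : X → X ⊕ K) ⁻¹' U) '' 𝒰 ∈ T.Cov ∧
    (fun U => (Sum.inr : K → X ⊕ K) ⁻¹' U) '' 𝒰 ∈ S.Cov}

/-- `Cov_K` consists exactly of the families `{K \ ψ⁻¹([X \ U]) : U ∈ 𝒰}` with `𝒰 ∈ Cov_X`;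
here `A` runs over the closed sets `X \ U`. -/
def Correlated (ψ : S.closedLattice ≃o T.LCl hlc) : Prop :=
  S.Cov = {𝒱 | ∃ 𝒰 ∈ T.Cov,
    𝒱 = {V | ∃ A : T.closedLattice, (A : Set X)ᶜ ∈ 𝒰 ∧ V = (ψ.symm (T.cls hlc A) : Set K)ᶜ}}

end Construction

end GTS

/-!
The map `A ↦ A* = ψ⁻¹([A])` (`GTS.remainder`) is a surjective lattice homomorphism from `Cl_X` onto
`Cl_K`, and `A* = ∅` exactly when `A` is compact. The complements of the sets `A ∪ A*`
(`GTS.basicOpen`) therefore form a basis of `τ` closed under finite unions, and disjoint open sets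
of `X` extend to disjoint basic sets.

* Compactness: finitely many members of a basic cover contain `K`; their union has a complement
  `B ∪ B*` with `B* = ∅`, so `B` is a compact subset of `X`.
* Hausdorff property: a point of `X` has an open neighbourhood inside a compact closed set, whose
  complement extends over all of `K`. Two points of `K` lie in disjoint `A*` and `B*`; then `A ∩ B`
  is compact, and once a neighbourhood of it with compact hull is removed from `A`, weak normality
  separates `A` and `B` by open sets of `X`, whose extensions separate the points.
* Density: the basic open set that misses `X` has `A = X`, and `X* = K`.

`Cov^s` is the intersection of three generalized topologies: `τ` with all families of open sets, and
the ones coinduced from `X` and from `K`. Hence it is a generalized topology, under no assumption on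
`ψ`. The correlation or smallness assumption is only needed to see that every admissible family of
`X` or `K` is a trace of an admissible family of `X ∪ K` (`GTS.exists_covS_inl`,
`GTS.exists_covS_inr`), which is what strictness means. In the correlated case the basic extensions
work. In the small case, if `V_1, …, V_n` have the same union as the family `𝒱` in `K`, and `A_V*`
is the complement of `V`, then each `A_V` is replaced by `A_V ∪ (A_{V_1} ∩ … ∩ A_{V_n})`, which has
the same remainder; this makes the trace on `X` essentially finite.
-/

/-! ### Constructions of generalized topologies -/

namespace IsGenTopology

variable {X : Type u} {Y : Type v} {Cov Cov' : Set (Set (Set X))}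

theorem singleton_mem_iff (h : IsGenTopology Cov) {U : Set X} : {U} ∈ Cov ↔ U ∈ ⋃₀ Cov :=
  ⟨fun hU => ⟨{U}, hU, rfl⟩, fun hU => h.finiteness _ (by simpa using hU) (Set.finite_singleton U)⟩

theorem subset_open {𝒰 : Set (Set X)} (h𝒰 : 𝒰 ∈ Cov) : 𝒰 ⊆ ⋃₀ Cov := fun _ hU => ⟨𝒰, h𝒰, hU⟩

theorem mem_sUnion_inter (h : IsGenTopology Cov) (h' : IsGenTopology Cov') {U : Set X} :
    U ∈ ⋃₀ (Cov ∩ Cov') ↔ U ∈ ⋃₀ Cov ∧ U ∈ ⋃₀ Cov' := by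
  constructor
  · rintro ⟨𝒰, h𝒰, hU⟩
    exact ⟨⟨𝒰, h𝒰.1, hU⟩, ⟨𝒰, h𝒰.2, hU⟩⟩
  · rintro ⟨h1, h2⟩
    exact ⟨{U}, ⟨h.singleton_mem_iff.2 h1, h'.singleton_mem_iff.2 h2⟩, rfl⟩

theorem inter (h : IsGenTopology Cov) (h' : IsGenTopology Cov') : IsGenTopology (Cov ∩ Cov') := by
  have key {U : Set X} : U ∈ ⋃₀ (Cov ∩ Cov') ↔ U ∈ ⋃₀ Cov ∧ U ∈ ⋃₀ Cov' := mem_sUnion_inter h h'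
  refine ⟨key.2 ⟨h.empty_open, h'.empty_open⟩, key.2 ⟨h.univ_open, h'.univ_open⟩, ?_, ?_, ?_, ?_,
    ?_, ?_, ?_, ?_⟩
  · intro U hU V hV
    rw [key] at hU hV ⊢
    exact ⟨h.inter_open _ hU.1 _ hV.1, h'.inter_open _ hU.2 _ hV.2⟩
  · intro U hU V hV
    rw [key] at hU hV ⊢
    exact ⟨h.union_open _ hU.1 _ hV.1, h'.union_open _ hU.2 _ hV.2⟩
  · exact fun 𝒰 h𝒰 hf => ⟨h.finiteness _ (fun U hU => (key.1 (h𝒰 hU)).1) hf,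
      h'.finiteness _ (fun U hU => (key.1 (h𝒰 hU)).2) hf⟩
  · exact fun 𝒰 h𝒰 => key.2 ⟨h.sUnion_open _ h𝒰.1, h'.sUnion_open _ h𝒰.2⟩
  · exact fun 𝒰 h𝒰 V hV => ⟨h.stability _ h𝒰.1 _ (key.1 hV).1, h'.stability _ h𝒰.2 _ (key.1 hV).2⟩
  · exact fun 𝒰 h𝒰 Φ hΦ =>
      ⟨h.transitivity _ h𝒰.1 Φ fun U hU => ⟨(hΦ U hU).1.1, (hΦ U hU).2⟩,
        h'.transitivity _ h𝒰.2 Φ fun U hU => ⟨(hΦ U hU).1.2, (hΦ U hU).2⟩⟩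
  · exact fun 𝒰 h𝒰 𝒱 h𝒱 he hr =>
      ⟨h.saturation _ (fun U hU => (key.1 (h𝒰 hU)).1) _ h𝒱.1 he hr,
        h'.saturation _ (fun U hU => (key.1 (h𝒰 hU)).2) _ h𝒱.2 he hr⟩
  · exact fun 𝒰 h𝒰 W hW hr => key.2 ⟨h.regularity _ h𝒰.1 W hW fun U hU => (key.1 (hr U hU)).1,
      h'.regularity _ h𝒰.2 W hW fun U hU => (key.1 (hr U hU)).2⟩

theorem mem_sUnion_isOpen [TopologicalSpace X] {U : Set X} :
    U ∈ ⋃₀ {𝒰 : Set (Set X) | ∀ U ∈ 𝒰, IsOpen U} ↔ IsOpen U :=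
  ⟨fun ⟨_, h𝒰, hU⟩ => h𝒰 U hU, fun hU => ⟨{U}, by simpa using hU, rfl⟩⟩

/-- A topology is a generalized topology in which all families of open sets are admissible. -/
theorem isOpen [TopologicalSpace X] :
    IsGenTopology {𝒰 : Set (Set X) | ∀ U ∈ 𝒰, IsOpen U} := by
  refine ⟨?_, ?_, ?_, ?_, ?_, ?_, ?_, ?_, ?_, ?_⟩ <;> try simp only [mem_sUnion_isOpen]
  · exact isOpen_empty
  · exact isOpen_univ
  · exact fun U hU V hV => hU.inter hV
  · exact fun U hU V hV => hU.union hV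
  · exact fun 𝒰 h𝒰 _ U hU => mem_sUnion_isOpen.1 (h𝒰 hU)
  · exact fun 𝒰 h𝒰 => isOpen_sUnion h𝒰
  · rintro 𝒰 h𝒰 V hV _ ⟨U, hU, rfl⟩
    exact hV.inter (h𝒰 U hU)
  · intro 𝒰 _ Φ hΦ W hW
    obtain ⟨U, hU, hW⟩ := Set.mem_iUnion₂.1 hW
    exact (hΦ U hU).1 W hW
  · exact fun 𝒰 h𝒰 _ _ _ _ U hU => mem_sUnion_isOpen.1 (h𝒰 hU)
  · intro 𝒰 _ W hW hr
    have : W = ⋃ U ∈ 𝒰, W ∩ U := by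
      rw [← Set.inter_iUnion₂, ← Set.sUnion_eq_biUnion, Set.inter_eq_left.2 hW]
    rw [this]
    exact isOpen_biUnion hr

theorem mem_sUnion_coinduced (h : IsGenTopology Cov) (f : X → Y) {U : Set Y} :
    U ∈ ⋃₀ {𝒰 : Set (Set Y) | (fun U => f ⁻¹' U) '' 𝒰 ∈ Cov} ↔ f ⁻¹' U ∈ ⋃₀ Cov := by
  constructor
  · rintro ⟨𝒰, h𝒰, hU⟩
    exact ⟨_, h𝒰, U, hU, rfl⟩
  · intro hU
    refine ⟨{U}, ?_, rfl⟩
    simpa [h.singleton_mem_iff] using hU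

/-- The families whose preimages under a map `f` are admissible form a generalized topology on the
codomain of `f`. -/
theorem coinduced (h : IsGenTopology Cov) (f : X → Y) :
    IsGenTopology {𝒰 : Set (Set Y) | (fun U => f ⁻¹' U) '' 𝒰 ∈ Cov} := by
  have key {U : Set Y} := mem_sUnion_coinduced h f (U := U)
  refine ⟨?_, ?_, ?_, ?_, ?_, ?_, ?_, ?_, ?_, ?_⟩ <;> try simp only [key]
  · exact h.empty_open
  · exact h.univ_open
  · exact fun U hU V hV => h.inter_open _ hU _ hV
  · exact fun U hU V hV => h.union_open _ hU _ hV
  · intro 𝒰 h𝒰 hf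
    refine h.finiteness _ ?_ (hf.image _)
    rintro _ ⟨U, hU, rfl⟩
    exact key.1 (h𝒰 hU)
  · intro 𝒰 h𝒰
    simpa [Set.sUnion_image, Set.preimage_sUnion] using h.sUnion_open _ h𝒰
  · intro 𝒰 h𝒰 V hV
    simpa [Set.image_image] using h.stability _ h𝒰 _ hV
  · intro 𝒰 h𝒰 Φ hΦ
    -- Distinct members of `𝒰` may have the same preimage `V`; the families that refine them
    -- are put together, and the joint refinement of `V` is admissible by saturation.
    have := h.transitivity _ h𝒰
      (fun V => ⋃ U ∈ {U ∈ 𝒰 | f ⁻¹' U = V}, (fun W => f ⁻¹' W) '' Φ U) ?_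
    · refine (Set.mem_of_eq_of_mem ?_ this : _ ∈ Cov)
      ext W
      simp only [Set.mem_image, Set.mem_iUnion, Set.mem_ofPred_eq, exists_prop]
      constructor
      · rintro ⟨W, ⟨U, hU, hW⟩, rfl⟩
        exact ⟨_, ⟨U, hU, rfl⟩, U, ⟨hU, rfl⟩, W, hW, rfl⟩
      · rintro ⟨_, -, U, ⟨hU, -⟩, W, hW, rfl⟩
        exact ⟨W, ⟨U, hU, hW⟩, rfl⟩
    · have hun : ∀ U ∈ 𝒰, ⋃₀ ((fun W => f ⁻¹' W) '' Φ U) = f ⁻¹' U := by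
        intro U hU
        conv_rhs => rw [← (hΦ U hU).2]
        rw [Set.sUnion_image, Set.preimage_sUnion]
      rintro _ ⟨U, hU, rfl⟩
      have hun' : ⋃₀ (⋃ U' ∈ {U' ∈ 𝒰 | f ⁻¹' U' = f ⁻¹' U}, (fun W => f ⁻¹' W) '' Φ U')
          = f ⁻¹' U := by
        apply subset_antisymm
        · rintro x ⟨W, hW, hx⟩
          obtain ⟨U', ⟨hU', he⟩, hW⟩ := Set.mem_iUnion₂.1 hW
          rw [← he, ← hun U' hU']
          exact ⟨W, hW, hx⟩
        · rw [← hun U hU]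
          exact Set.sUnion_subset_sUnion fun W hW => Set.mem_iUnion₂.2 ⟨U, ⟨hU, hun U hU ▸ rfl⟩, hW⟩
      refine ⟨h.saturation _ ?_ _ (hΦ U hU).1 (hun'.trans (hun U hU).symm) ?_, hun'⟩
      · intro W hW
        obtain ⟨U', ⟨hU', -⟩, hW⟩ := Set.mem_iUnion₂.1 hW
        exact ⟨_, (hΦ U' hU').1, hW⟩
      · exact fun W hW => ⟨W, Set.mem_iUnion₂.2 ⟨U, ⟨hU, rfl⟩, hW⟩, subset_rfl⟩
  · intro 𝒰 h𝒰 𝒱 h𝒱 he hr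
    refine h.saturation _ ?_ _ h𝒱 ?_ ?_
    · rintro _ ⟨U, hU, rfl⟩
      exact key.1 (h𝒰 hU)
    · rw [Set.sUnion_image, Set.sUnion_image, ← Set.preimage_sUnion, he, Set.preimage_sUnion]
    · rintro _ ⟨V, hV, rfl⟩
      obtain ⟨U, hU, hVU⟩ := hr V hV
      exact ⟨_, ⟨U, hU, rfl⟩, Set.preimage_mono hVU⟩
  · intro 𝒰 h𝒰 W hW hr
    refine h.regularity _ h𝒰 _ ?_ ?_
    · rw [Set.sUnion_image, ← Set.preimage_sUnion]
      exact Set.preimage_mono hW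
    · rintro _ ⟨U, hU, rfl⟩
      exact hr U hU

theorem genTopologyGenerated_eq (h : IsGenTopology Cov) : genTopologyGenerated Cov = Cov :=
  subset_antisymm (fun _ h𝒰 => h𝒰 Cov h subset_rfl) fun _ h𝒰 _ _ hs => hs h𝒰

theorem imageOn {f : X → Y} (h : IsGenTopology Cov) (hf : Function.Injective f) :
    IsGenTopology (imageOn f Cov) := by
  have hb : Function.Bijective (Set.rangeFactorization f) :=
    ⟨Set.rangeFactorization_injective.2 hf, Set.rangeFactorization_surjective⟩
  convert h.coinduced (Set.rangeFactorization f) using 1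
  ext 𝒲
  constructor
  · rintro ⟨𝒰, h𝒰, rfl⟩
    simpa [Set.image_image, Set.preimage_image_eq _ hb.1] using h𝒰
  · intro h𝒲
    refine ⟨_, h𝒲, ?_⟩
    simp [Set.image_image, Set.image_preimage_eq _ hb.2]

end IsGenTopology

/-- Traces on the range of `f` are preimages under `f`, transported along `X ≃ range f`. -/
theorem traceOn_range {X : Type u} {Y : Type v} {f : X → Y} (𝒜 : Set (Set (Set Y))) :
    traceOn 𝒜 (Set.range f) = imageOn f {𝒰 | ∃ 𝒲 ∈ 𝒜, (fun W => f ⁻¹' W) '' 𝒲 = 𝒰} := by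
  have hval (W : Set Y) : Set.rangeFactorization f '' (f ⁻¹' W) =
      (Subtype.val : Set.range f → Y) ⁻¹' W := by
    conv_rhs => rw [← Set.image_preimage_eq (Subtype.val ⁻¹' W)
      (Set.rangeFactorization_surjective (f := f))]
    rfl
  ext 𝒱
  constructor
  · rintro ⟨𝒲, h𝒲, rfl⟩
    exact ⟨_, ⟨𝒲, h𝒲, rfl⟩, by simp only [Set.image_image, hval]⟩
  · rintro ⟨_, ⟨𝒲, h𝒲, rfl⟩, rfl⟩
    exact ⟨𝒲, h𝒲, by simp only [Set.image_image, hval]⟩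

theorem imageOn_mono {X : Type u} {Y : Type v} {f : X → Y} {𝒜 ℬ : Set (Set (Set X))}
    (h : 𝒜 ⊆ ℬ) : imageOn f 𝒜 ⊆ imageOn f ℬ := fun _ ⟨𝒰, h𝒰, he⟩ => ⟨𝒰, h h𝒰, he⟩

namespace GTS

/-! ### Separation in topologizations -/

section Separation

variable {X : Type u} {T : GTS X}

theorem compl_mem_Cl {U : Set X} : Uᶜ ∈ T.Cl ↔ U ∈ T.Op := by
  simp [Cl]

theorem empty_mem_Cl : ∅ ∈ T.Cl :=
  Set.mem_of_eq_of_mem (s := T.Op) Set.compl_empty T.isGenTopology.univ_open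

theorem univ_mem_Cl : Set.univ ∈ T.Cl :=
  Set.mem_of_eq_of_mem (s := T.Op) Set.compl_univ T.isGenTopology.empty_open

/-- In a topologically compact weakly Hausdorff gts, distinct points lie in disjoint closed sets,
although singletons need not be closed. -/
theorem exists_disjoint_Cl (hT : T.WeaklyHausdorff) (hc : T.TopCompact) {x y : X} (hxy : x ≠ y) :
    ∃ E ∈ T.Cl, ∃ F ∈ T.Cl, Disjoint E F ∧ x ∈ E ∧ y ∈ F := by
  let _ := T.top
  have _ : T2Space X := hT
  have _ : CompactSpace X := hc
  have hb := T.isTopologicalBasis_Op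
  obtain ⟨V, W, hV, hW, hxV, hyW, hVW⟩ := t2_separation hxy
  obtain ⟨V', hV', hxV', hVV'⟩ := hb.exists_subset_of_mem_open hxV hV
  have hcompact : IsCompact V'ᶜ := (hb.isOpen hV').isClosed_compl.isCompact
  obtain ⟨O, hO, hxO, hsO⟩ : ∃ O ∈ T.Op, x ∉ O ∧ V'ᶜ ⊆ O := by
    refine hcompact.induction_on (p := fun s => ∃ O ∈ T.Op, x ∉ O ∧ s ⊆ O) ?_ ?_ ?_ ?_
    · exact ⟨∅, T.isGenTopology.empty_open, by simp, subset_rfl⟩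
    · exact fun s t hst ⟨O, hO, hxO, htO⟩ => ⟨O, hO, hxO, hst.trans htO⟩
    · exact fun s t ⟨O, hO, hxO, hs⟩ ⟨O', hO', hxO', ht⟩ => ⟨O ∪ O',
        T.isGenTopology.union_open _ hO _ hO', by simp [hxO, hxO'], Set.union_subset_union hs ht⟩
    · intro z hz
      have hzx : z ∈ ({x} : Set X)ᶜ := fun h => hz (h ▸ hxV')
      obtain ⟨O, hO, hzO, hOs⟩ := hb.exists_subset_of_mem_open hzx isClosed_singleton.isOpen_compl
      exact ⟨O, mem_nhdsWithin_of_mem_nhds (hb.mem_nhds hO hzO), O, hO, fun h => hOs h rfl,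
        subset_rfl⟩
  exact ⟨Oᶜ, compl_mem_Cl.2 hO, V'ᶜ, compl_mem_Cl.2 hV',
    Set.disjoint_left.2 fun z hz hz' => hz (hsO hz'), hxO,
    fun h => Set.disjoint_left.1 hVW (hVV' h) hyW⟩

/-- In a weakly normal locally compact gts, every compact set `N` has a compact neighbourhood `C`
in `Cl_X`, witnessed by a `U` in `Op_X`; closedness in the topologization would not suffice to form
the class `[C]`. -/
theorem exists_Op_subset_compact_Cl (hX : T.WeaklyNormal) (hlc : T.TopLocallyCompact) {N : Set X}
    (hN : T.TopCompactSet N) :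
    ∃ U ∈ T.Op, ∃ C ∈ T.Cl, T.TopCompactSet C ∧ N ⊆ U ∧ U ⊆ C := by
  let _ := T.top
  have _ : LocallyCompactSpace X := hlc
  refine IsCompact.induction_on (s := N)
    (p := fun s => ∃ U ∈ T.Op, ∃ C ∈ T.Cl, T.TopCompactSet C ∧ s ⊆ U ∧ U ⊆ C) hN ?_ ?_ ?_ ?_
  · exact ⟨∅, T.isGenTopology.empty_open, ∅,
      empty_mem_Cl, isCompact_empty, subset_rfl, subset_rfl⟩
  · exact fun s t hst ⟨U, hU, C, hC, hCc, hs, hUC⟩ => ⟨U, hU, C, hC, hCc, hst.trans hs, hUC⟩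
  · exact fun s t ⟨U, hU, C, hC, hCc, hs, hUC⟩ ⟨V, hV, D, hD, hDc, ht, hVD⟩ =>
      ⟨U ∪ V, T.isGenTopology.union_open _ hU _ hV, C ∪ D, T.union_mem_Cl hC hD,
        IsCompact.union hCc hDc, Set.union_subset_union hs ht, Set.union_subset_union hUC hVD⟩
  · intro x _
    obtain ⟨M, hM, hxM⟩ := exists_compact_mem_nhds x
    obtain ⟨U, hU, hxU, hUM⟩ := T.isTopologicalBasis_Op.mem_nhds_iff.1 hxM
    obtain ⟨W₁, hW₁, W₂, hW₂, hd, h1, h2⟩ := hX {x} Uᶜ (Or.inl ⟨x, rfl⟩)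
      (Or.inr (compl_mem_Cl.2 hU)) (by simpa using hxU)
    have hC := compl_mem_Cl.2 hW₂
    refine ⟨W₁, mem_nhdsWithin_of_mem_nhds (T.isTopologicalBasis_Op.mem_nhds hW₁ (h1 rfl)),
      W₁, hW₁, W₂ᶜ, hC, ?_, subset_rfl, Set.subset_compl_iff_disjoint_right.2 hd⟩
    exact hM.of_isClosed_subset (T.isClosed_of_mem_Cl hC)
      ((Set.compl_subset_comm.1 h2).trans hUM)

end Separation

/-! ### The trace at infinity of a closed set -/

section Remainder

variable {X : Type u} {K : Type v} {T : GTS X} {S : GTS K} {hlc : T.TopLocallyCompact}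
  (ψ : S.closedLattice ≃o T.LCl hlc)

/-- The trace `ψ⁻¹([A])` on the remainder `K` of a closed set `A` of `X`. -/
def remainder (A : T.closedLattice) : S.closedLattice := ψ.symm (T.cls hlc A)

/-- The basic open set of `X ∪ K` with complement `A ∪ ψ⁻¹([A])`. -/
def basicOpen (A : T.closedLattice) : Set (X ⊕ K) :=
  (Sum.inl '' (A : Set X) ∪ Sum.inr '' (remainder ψ A : Set K))ᶜ

theorem opW_eq_range : opW ψ = Set.range (basicOpen ψ) := by
  ext U
  constructor
  · rintro ⟨A, hA⟩
    exact ⟨A, by rw [← compl_compl U, hA]; rfl⟩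
  · rintro ⟨A, rfl⟩
    exact ⟨A, compl_compl _⟩

variable {ψ} {A B : T.closedLattice}

@[simp] theorem inl_mem_basicOpen {x : X} : Sum.inl x ∈ basicOpen ψ A ↔ x ∉ (A : Set X) := by
  simp [basicOpen]

@[simp] theorem inr_mem_basicOpen {k : K} :
    Sum.inr k ∈ basicOpen ψ A ↔ k ∉ (remainder ψ A : Set K) := by
  simp [basicOpen]

theorem inl_preimage_basicOpen : Sum.inl ⁻¹' basicOpen ψ A = (A : Set X)ᶜ := by
  ext x; simp

theorem inr_preimage_basicOpen : Sum.inr ⁻¹' basicOpen ψ A = (remainder ψ A : Set K)ᶜ := by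
  ext x; simp

theorem remainder_surjective : Function.Surjective (remainder ψ) := fun C => by
  obtain ⟨A, hA⟩ := cls_surjective (ψ C)
  exact ⟨A, by simp [remainder, hA]⟩

theorem remainder_sup : remainder ψ (A ⊔ B) = remainder ψ A ⊔ remainder ψ B :=
  OrderIso.map_sup ψ.symm (T.cls hlc A) (T.cls hlc B)

theorem remainder_inf : remainder ψ (A ⊓ B) = remainder ψ A ⊓ remainder ψ B :=
  OrderIso.map_inf ψ.symm (T.cls hlc A) (T.cls hlc B)

theorem remainder_mono (h : (A : Set X) ⊆ B) :
    (remainder ψ A : Set K) ⊆ remainder ψ B := by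
  have : A ⊓ B = A := inf_eq_left.2 h
  rw [← this, remainder_inf]
  exact Set.inter_subset_right

theorem coe_remainder_sup :
    (remainder ψ (A ⊔ B) : Set K) = (remainder ψ A : Set K) ∪ remainder ψ B := by
  rw [remainder_sup]; rfl

theorem coe_remainder_inf :
    (remainder ψ (A ⊓ B) : Set K) = (remainder ψ A : Set K) ∩ remainder ψ B := by
  rw [remainder_inf]; rfl

theorem remainder_eq_iff : remainder ψ A = remainder ψ B ↔ T.Sim A B := by
  rw [remainder, remainder, ψ.symm.injective.eq_iff]
  exact Quotient.eq (r := T.simSetoid hlc)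

theorem remainder_empty : (remainder ψ ⟨∅, empty_mem_Cl⟩ : Set K) = ∅ := by
  obtain ⟨A, hA⟩ := remainder_surjective (ψ := ψ) ⟨∅, empty_mem_Cl⟩
  exact Set.subset_empty_iff.1 ((remainder_mono (B := A) (Set.empty_subset _)).trans (by rw [hA]))

theorem remainder_univ : (remainder ψ ⟨Set.univ, univ_mem_Cl⟩ : Set K) = Set.univ := by
  obtain ⟨A, hA⟩ := remainder_surjective (ψ := ψ) ⟨Set.univ, univ_mem_Cl⟩
  refine Set.univ_subset_iff.1 (subset_trans ?_ (remainder_mono (A := A) (Set.subset_univ _)))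
  rw [hA]

/-- A closed set is compact iff it does not reach the remainder. -/
theorem remainder_eq_empty_iff : (remainder ψ A : Set K) = ∅ ↔ T.TopCompactSet A := by
  have h : (remainder ψ A : Set K) = ∅ ↔ T.Sim A ⟨∅, empty_mem_Cl⟩ := by
    rw [← remainder_eq_iff (ψ := ψ), ← Subtype.coe_inj, remainder_empty]
  rw [h]
  constructor
  · exact fun h => h _ A.2 (by simp [Set.symmDiff_def])
  · intro hA D hD hs
    refine @IsCompact.of_isClosed_subset X T.top _ _ hA (T.isClosed_of_mem_Cl hD) ?_
    simpa [Set.symmDiff_def] using hs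

theorem basicOpen_inter : basicOpen ψ A ∩ basicOpen ψ B = basicOpen ψ (A ⊔ B) := by
  ext (x | k)
  · simp
  · simp [coe_remainder_sup]

theorem basicOpen_union : basicOpen ψ A ∪ basicOpen ψ B = basicOpen ψ (A ⊓ B) := by
  ext (x | k)
  · simp [imp_iff_not_or]
  · simp [coe_remainder_inf, imp_iff_not_or]

theorem basicOpen_empty : basicOpen ψ ⟨∅, empty_mem_Cl⟩ = Set.univ := by
  ext (x | k)
  · simp
  · simp [remainder_empty]

theorem basicOpen_univ : basicOpen ψ ⟨Set.univ, univ_mem_Cl⟩ = ∅ := by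
  ext (x | k)
  · simp
  · simp [remainder_univ]

theorem disjoint_basicOpen (h : Disjoint (A : Set X)ᶜ (B : Set X)ᶜ) :
    Disjoint (basicOpen ψ A) (basicOpen ψ B) := by
  have : A ⊔ B = ⟨Set.univ, univ_mem_Cl⟩ := Subtype.ext (by
    rw [Set.disjoint_compl_left_iff_subset] at h
    exact Set.univ_subset_iff.1 fun x _ => by
      by_cases hx : x ∈ (A : Set X)
      · exact Or.inl hx
      · exact Or.inr (not_not.1 fun hB => hx (h hB)))
  rw [Set.disjoint_iff_inter_eq_empty, basicOpen_inter, this, basicOpen_univ]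

theorem finite_sUnion_mem_opW {𝒰 : Set (Set (X ⊕ K))} (hf : 𝒰.Finite) (h : 𝒰 ⊆ opW ψ) :
    ⋃₀ 𝒰 ∈ opW ψ := by
  rw [opW_eq_range] at h ⊢
  induction 𝒰, hf using Set.Finite.induction_on with
  | empty => exact ⟨_, basicOpen_univ.trans Set.sUnion_empty.symm⟩
  | insert _ _ ih =>
    obtain ⟨B, hB⟩ := ih fun U hU => h (Or.inr hU)
    obtain ⟨A, hA⟩ := h (Or.inl rfl)
    exact ⟨A ⊓ B, by rw [Set.sUnion_insert, ← hA, ← hB, basicOpen_union]⟩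

/-! ### The topology of the compactification -/

theorem isTopologicalBasis_opW : @TopologicalSpace.IsTopologicalBasis _ (topW ψ) (opW ψ) := by
  let _ := topW ψ
  have h := TopologicalSpace.isTopologicalBasis_of_subbasis_of_inter (r := opW ψ) rfl (by
    rw [opW_eq_range]
    rintro _ ⟨A, rfl⟩ _ ⟨B, rfl⟩
    exact ⟨_, basicOpen_inter.symm⟩)
  rwa [Set.insert_eq_of_mem
    (by rw [opW_eq_range]; exact ⟨_, basicOpen_empty⟩ : Set.univ ∈ opW ψ)] at h

theorem basicOpen_mem_opW : basicOpen ψ A ∈ opW ψ := by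
  rw [opW_eq_range]; exact ⟨A, rfl⟩

theorem isOpen_basicOpen : IsOpen[topW ψ] (basicOpen ψ A) :=
  TopologicalSpace.isOpen_generateFrom_of_mem basicOpen_mem_opW

/-- Disjoint open sets of `X` extend to disjoint open sets of `X ∪ K`. -/
theorem disjoint_basicOpen_of_disjoint {W₁ W₂ : Set X} (h₁ : W₁ ∈ T.Op) (h₂ : W₂ ∈ T.Op)
    (h : Disjoint W₁ W₂) :
    Disjoint (basicOpen ψ ⟨W₁ᶜ, compl_mem_Cl.2 h₁⟩) (basicOpen ψ ⟨W₂ᶜ, compl_mem_Cl.2 h₂⟩) :=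
  disjoint_basicOpen (by simpa using h)

/-- Points of the remainder lie in the remainders of disjoint closed sets of `X`. -/
theorem exists_disjoint_remainder (hX : T.WeaklyNormal) (hK : S.WeaklyHausdorff)
    (hKc : S.TopCompact) {k l : K} (hkl : k ≠ l) :
    ∃ A B : T.closedLattice, Disjoint (A : Set X) B ∧
      k ∈ (remainder ψ A : Set K) ∧ l ∈ (remainder ψ B : Set K) := by
  obtain ⟨E, hE, F, hF, hEF, hk, hl⟩ := exists_disjoint_Cl hK hKc hkl
  obtain ⟨A, hA⟩ := remainder_surjective (ψ := ψ) ⟨E, hE⟩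
  obtain ⟨B, hB⟩ := remainder_surjective (ψ := ψ) ⟨F, hF⟩
  have hAB : T.TopCompactSet (A ⊓ B : T.closedLattice) := by
    rw [← remainder_eq_empty_iff (ψ := ψ), coe_remainder_inf, hA, hB]
    exact Set.disjoint_iff_inter_eq_empty.1 hEF
  -- Cutting a neighbourhood of the compact set `A ∩ B` out of `A` does not change `[A]`.
  obtain ⟨U, hU, C, hC, hCc, hABU, hUC⟩ := exists_Op_subset_compact_Cl hX hlc hAB
  have hC' : (remainder ψ ⟨C, hC⟩ : Set K) = ∅ := remainder_eq_empty_iff.2 hCc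
  refine ⟨A ⊓ ⟨Uᶜ, compl_mem_Cl.2 hU⟩, B, ?_, ?_, by rw [hB]; exact hl⟩
  · exact Set.disjoint_left.2 fun x hx hxB => hx.2 (hABU ⟨hx.1, hxB⟩)
  · have h : (remainder ψ A : Set K) ⊆
        remainder ψ (A ⊓ ⟨Uᶜ, compl_mem_Cl.2 hU⟩ ⊔ ⟨C, hC⟩) := remainder_mono fun x hx => by
      by_cases hxU : x ∈ U
      · exact Or.inr (hUC hxU)
      · exact Or.inl ⟨hx, hxU⟩
    rw [coe_remainder_sup, hC', Set.union_empty, hA] at h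
    exact h hk

theorem t2Space_topW (hX : T.WeaklyNormal) (hK : S.WeaklyHausdorff) (hKc : S.TopCompact) :
    @T2Space _ (topW ψ) := by
  let _ := topW ψ
  have key : ∀ p q : X ⊕ K, (∃ W₁, ∃ h₁ : W₁ ∈ T.Op, ∃ W₂, ∃ h₂ : W₂ ∈ T.Op, Disjoint W₁ W₂ ∧
      p ∈ basicOpen ψ ⟨W₁ᶜ, compl_mem_Cl.2 h₁⟩ ∧ q ∈ basicOpen ψ ⟨W₂ᶜ, compl_mem_Cl.2 h₂⟩) →
      ∃ U V : Set (X ⊕ K), IsOpen U ∧ IsOpen V ∧ p ∈ U ∧ q ∈ V ∧ Disjoint U V :=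
    fun p q ⟨W₁, h₁, W₂, h₂, hd, hp, hq⟩ => ⟨_, _, isOpen_basicOpen, isOpen_basicOpen, hp, hq,
      disjoint_basicOpen_of_disjoint h₁ h₂ hd⟩
  have mixed (x : X) (k : K) : ∃ U V : Set (X ⊕ K), IsOpen U ∧ IsOpen V ∧ Sum.inl x ∈ U ∧
      Sum.inr k ∈ V ∧ Disjoint U V := by
    obtain ⟨U, hU, C, hC, hCc, hxU, hUC⟩ :=
      exists_Op_subset_compact_Cl hX hlc (N := {x}) (@isCompact_singleton _ T.top x)
    refine key _ _ ⟨U, hU, Cᶜ, hC, Set.disjoint_compl_right_iff_subset.2 hUC, ?_, ?_⟩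
    · simpa using hxU
    · have := (remainder_eq_empty_iff (ψ := ψ) (A := ⟨C, hC⟩)).2 hCc
      simp [this]
  refine ⟨?_⟩
  rintro (x | k) (y | l) hne
  · obtain ⟨W₁, h₁, W₂, h₂, hd, hx, hy⟩ := hX {x} {y} (Or.inl ⟨x, rfl⟩) (Or.inl ⟨y, rfl⟩)
      (by simpa using hne)
    exact key _ _ ⟨W₁, h₁, W₂, h₂, hd, by simpa using hx, by simpa using hy⟩
  · exact mixed x l
  · obtain ⟨U, V, hU, hV, hy, hk, hd⟩ := mixed y k
    exact ⟨V, U, hV, hU, hk, hy, hd.symm⟩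
  · obtain ⟨A, B, hAB, hk, hl⟩ := exists_disjoint_remainder (ψ := ψ) hX hK hKc
      (fun h => hne (congrArg _ h) : k ≠ l)
    obtain ⟨W₁, h₁, W₂, h₂, hd, hA, hB⟩ := hX A B (Or.inr A.2) (Or.inr B.2) hAB
    have aux {A : T.closedLattice} {W : Set X} (h : W ∈ T.Op) (hA : (A : Set X) ⊆ W) {k : K}
        (hk : k ∈ (remainder ψ A : Set K)) :
        Sum.inr k ∈ basicOpen ψ ⟨Wᶜ, compl_mem_Cl.2 h⟩ := by
      rw [inr_mem_basicOpen]
      intro hk'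
      have h0 : A ⊓ ⟨Wᶜ, compl_mem_Cl.2 h⟩ = ⟨∅, empty_mem_Cl⟩ :=
        Subtype.ext (Set.disjoint_iff_inter_eq_empty.1 (Set.disjoint_compl_right_iff_subset.2 hA))
      have h1 := coe_remainder_inf (ψ := ψ) (A := A) (B := ⟨Wᶜ, compl_mem_Cl.2 h⟩)
      rw [h0, remainder_empty] at h1
      exact h1.symm.subset ⟨hk, hk'⟩
    exact key _ _ ⟨W₁, h₁, W₂, h₂, hd, aux h₁ hA hk, aux h₂ hB hl⟩

theorem compactSpace_topW (hKc : S.TopCompact) : @CompactSpace _ (topW ψ) := by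
  let _ := topW ψ
  let _ := T.top
  let _ := S.top
  have _ : CompactSpace K := hKc
  refine ⟨isCompact_generateFrom rfl fun P hP hcov => ?_⟩
  -- Finitely many members of the cover contain `K`, and the rest of `X` is then compact.
  obtain ⟨Q, hQP, hQ, hKQ⟩ := (isCompact_univ (X := K)).elim_finite_subcover_image (b := P)
    (c := fun U => Sum.inr ⁻¹' U) (fun U hU => by
      obtain ⟨A, rfl⟩ := (opW_eq_range ψ).subset (hP hU)
      rw [inr_preimage_basicOpen]
      exact (S.isClosed_of_mem_Cl (remainder ψ A).2).isOpen_compl)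
    fun k _ => by
      obtain ⟨U, hU, hk⟩ := hcov (Set.mem_univ (Sum.inr k))
      exact Set.mem_iUnion₂.2 ⟨U, hU, hk⟩
  obtain ⟨B, hB⟩ := (opW_eq_range ψ).subset (finite_sUnion_mem_opW hQ (hQP.trans hP))
  have hBc : IsCompact (B : Set X) := by
    refine (remainder_eq_empty_iff (ψ := ψ)).1 (Set.eq_empty_of_forall_notMem fun k => ?_)
    rw [← inr_mem_basicOpen, hB]
    obtain ⟨U, hU, hk⟩ := Set.mem_iUnion₂.1 (hKQ (Set.mem_univ k))
    exact ⟨U, hU, hk⟩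
  obtain ⟨R, hRP, hR, hBR⟩ := hBc.elim_finite_subcover_image (b := P)
    (c := fun U => Sum.inl ⁻¹' U) (fun U hU => by
      obtain ⟨A, rfl⟩ := (opW_eq_range ψ).subset (hP hU)
      rw [inl_preimage_basicOpen]
      exact (T.isClosed_of_mem_Cl A.2).isOpen_compl)
    fun x _ => by
      obtain ⟨U, hU, hx⟩ := hcov (Set.mem_univ (Sum.inl x))
      exact Set.mem_iUnion₂.2 ⟨U, hU, hx⟩
  refine ⟨Q ∪ R, Set.union_subset hQP hRP, hQ.union hR, ?_⟩
  rintro (x | k) -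
  · by_cases hx : x ∈ (B : Set X)
    · obtain ⟨U, hU, hx⟩ := Set.mem_iUnion₂.1 (hBR hx)
      exact ⟨U, Or.inr hU, hx⟩
    · rw [← inl_mem_basicOpen (ψ := ψ), hB] at hx
      exact Set.sUnion_mono Set.subset_union_left hx
  · obtain ⟨U, hU, hk⟩ := Set.mem_iUnion₂.1 (hKQ (Set.mem_univ k))
    exact ⟨U, Or.inl hU, hk⟩

theorem dense_range_inl : @Dense _ (topW ψ) (Set.range Sum.inl) := by
  let _ := topW ψ
  refine isTopologicalBasis_opW.dense_iff.2 fun U hU hne => ?_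
  obtain ⟨A, rfl⟩ := (opW_eq_range ψ).subset hU
  have hA : (A : Set X) ≠ Set.univ := fun h => by
    have : A = ⟨Set.univ, univ_mem_Cl⟩ := Subtype.ext h
    rw [this, basicOpen_univ] at hne
    exact Set.not_nonempty_empty hne
  obtain ⟨x, hx⟩ := (Set.ne_univ_iff_exists_notMem _).1 hA
  exact ⟨Sum.inl x, inl_mem_basicOpen.2 hx, x, rfl⟩

/-! ### The admissible families of the compactification -/

theorem covS_eq : covS ψ = {𝒰 | ∀ U ∈ 𝒰, IsOpen[topW ψ] U} ∩
    ({𝒰 | (fun U => Sum.inl ⁻¹' U) '' 𝒰 ∈ T.Cov} ∩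
      {𝒰 | (fun U => Sum.inr ⁻¹' U) '' 𝒰 ∈ S.Cov}) := by
  ext 𝒰
  constructor
  · exact fun h => ⟨fun U hU => (h.1 hU).1, h.2⟩
  · exact fun h => ⟨fun U hU => ⟨h.1 U hU, ⟨_, h.2.1, U, hU, rfl⟩, ⟨_, h.2.2, U, hU, rfl⟩⟩, h.2⟩

theorem isGenTopology_covS : IsGenTopology (covS ψ) := by
  let _ := topW ψ
  rw [covS_eq]
  exact IsGenTopology.isOpen.inter ((T.isGenTopology.coinduced _).inter
    (S.isGenTopology.coinduced _))

theorem sUnion_covS : ⋃₀ covS ψ = opS ψ := by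
  let _ := topW ψ
  ext U
  rw [covS_eq, IsGenTopology.isOpen.mem_sUnion_inter ((T.isGenTopology.coinduced _).inter
    (S.isGenTopology.coinduced _)), (T.isGenTopology.coinduced _).mem_sUnion_inter
    (S.isGenTopology.coinduced _), IsGenTopology.mem_sUnion_isOpen,
    T.isGenTopology.mem_sUnion_coinduced, S.isGenTopology.mem_sUnion_coinduced]
  rfl

theorem basicOpen_mem_opS : basicOpen ψ A ∈ opS ψ :=
  ⟨isOpen_basicOpen, by rw [inl_preimage_basicOpen]; exact A.2,
    by rw [inr_preimage_basicOpen]; exact (remainder ψ A).2⟩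

theorem generateFrom_opS : TopologicalSpace.generateFrom (opS ψ) = topW ψ := by
  apply le_antisymm
  · apply TopologicalSpace.generateFrom_anti
    rw [opW_eq_range]
    rintro _ ⟨A, rfl⟩
    exact basicOpen_mem_opS
  · exact le_generateFrom fun U hU => hU.1

/-- The families of basic open sets indexed by `𝒜` are admissible as soon as their traces are. -/
theorem image_basicOpen_mem_covS {𝒜 : Set T.closedLattice}
    (hX : (fun A : T.closedLattice => (A : Set X)ᶜ) '' 𝒜 ∈ T.Cov)
    (hK : (fun A => (remainder ψ A : Set K)ᶜ) '' 𝒜 ∈ S.Cov) : basicOpen ψ '' 𝒜 ∈ covS ψ := by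
  refine ⟨?_, ?_, ?_⟩
  · rintro _ ⟨A, -, rfl⟩
    exact basicOpen_mem_opS
  · simpa only [Set.image_image, inl_preimage_basicOpen] using hX
  · simpa only [Set.image_image, inr_preimage_basicOpen] using hK

theorem image_compl_setOf {𝒰 : Set (Set X)} (h : 𝒰 ⊆ T.Op) :
    (fun A : T.closedLattice => (A : Set X)ᶜ) '' {A | (A : Set X)ᶜ ∈ 𝒰} = 𝒰 := by
  ext U
  constructor
  · rintro ⟨A, hA, rfl⟩
    exact hA
  · exact fun hU => ⟨⟨Uᶜ, compl_mem_Cl.2 (h hU)⟩, by simpa using hU, compl_compl U⟩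

theorem correlated_iff : Correlated ψ ↔ S.Cov = {𝒱 | ∃ 𝒰 ∈ T.Cov,
    𝒱 = (fun A => (remainder ψ A : Set K)ᶜ) '' {A | (A : Set X)ᶜ ∈ 𝒰}} := by
  have (𝒰 : Set (Set X)) : {V | ∃ A : T.closedLattice, (A : Set X)ᶜ ∈ 𝒰 ∧
      V = (ψ.symm (T.cls hlc A) : Set K)ᶜ} =
      (fun A => (remainder ψ A : Set K)ᶜ) '' {A | (A : Set X)ᶜ ∈ 𝒰} := by
    ext V
    exact exists_congr fun A => and_congr_right fun _ => eq_comm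
  simp only [Correlated, this]

/-- The remainder of a finite intersection `B` of closed sets is the intersection of their
remainders; stated for complements, since it is applied to finite covers. -/
theorem exists_finite_inf {𝒬 : Set T.closedLattice} (hf : 𝒬.Finite) :
    ∃ B : T.closedLattice, (B : Set X)ᶜ = ⋃ A ∈ 𝒬, (A : Set X)ᶜ ∧
      (remainder ψ B : Set K)ᶜ = ⋃ A ∈ 𝒬, (remainder ψ A : Set K)ᶜ := by
  have h : basicOpen ψ '' 𝒬 ⊆ opW ψ := by
    rintro _ ⟨A, -, rfl⟩
    exact basicOpen_mem_opW
  obtain ⟨B, hB⟩ := (opW_eq_range ψ).subset (finite_sUnion_mem_opW (hf.image _) h)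
  refine ⟨B, ?_, ?_⟩
  · rw [← inl_preimage_basicOpen (ψ := ψ), hB, Set.sUnion_image, Set.preimage_iUnion₂]
    simp only [inl_preimage_basicOpen]
  · rw [← inr_preimage_basicOpen, hB, Set.sUnion_image, Set.preimage_iUnion₂]
    simp only [inr_preimage_basicOpen]

theorem image_mem_Cov_of_finite {Y : Type*} {S : GTS Y} (hS : S.IsSmall) {ι : Type*}
    {𝒜 𝒬 : Set ι} (hQ : 𝒬 ⊆ 𝒜) (hf : 𝒬.Finite) {f : ι → Set Y} (hf' : ∀ i ∈ 𝒜, f i ∈ S.Op)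
    (h : ∀ i ∈ 𝒜, f i ⊆ ⋃ j ∈ 𝒬, f j) : f '' 𝒜 ∈ S.Cov := by
  rw [hS]
  refine ⟨Set.image_subset_iff.2 hf', f '' 𝒬, Set.image_mono hQ, hf.image f, ?_⟩
  rw [Set.sUnion_image, Set.sUnion_image]
  exact subset_antisymm (Set.iUnion₂_subset h) (Set.biUnion_subset_biUnion_left hQ)

/-- Every admissible family of `X` is the trace of an admissible family of `X ∪ K`. -/
theorem exists_covS_inl (h : Correlated ψ ∨ (T.IsSmall ∧ S.IsSmall)) {𝒰 : Set (Set X)}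
    (h𝒰 : 𝒰 ∈ T.Cov) : ∃ 𝒲 ∈ covS ψ, (fun W => Sum.inl ⁻¹' W) '' 𝒲 = 𝒰 := by
  have him := image_compl_setOf (IsGenTopology.subset_open h𝒰)
  -- Each `U` extends to the basic open set `U ∪ (K \ ψ⁻¹([X \ U]))`.
  refine ⟨basicOpen ψ '' {A | (A : Set X)ᶜ ∈ 𝒰}, image_basicOpen_mem_covS (by rwa [him]) ?_,
    by simpa only [Set.image_image, inl_preimage_basicOpen] using him⟩
  rcases h with h | ⟨hT, hS⟩
  · rw [correlated_iff.1 h]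
    exact ⟨𝒰, h𝒰, rfl⟩
  · obtain ⟨h𝒰o, 𝒱, h𝒱, hf, hun⟩ := hT.subset h𝒰
    have hfin : {A : T.closedLattice | (A : Set X)ᶜ ∈ 𝒱}.Finite :=
      hf.preimage (compl_injective.comp Subtype.val_injective).injOn
    obtain ⟨B, hB, hB'⟩ := exists_finite_inf (ψ := ψ) hfin
    refine image_mem_Cov_of_finite hS (𝒬 := {A : T.closedLattice | (A : Set X)ᶜ ∈ 𝒱}) (fun A hA => h𝒱 hA) hfin
      (fun A _ => (remainder ψ A).2) fun A hA => ?_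
    rw [← hB']
    refine Set.compl_subset_compl.2 (remainder_mono (Set.compl_subset_compl.1 ?_))
    rw [hB, ← Set.sUnion_image, image_compl_setOf (h𝒱.trans h𝒰o), ← hun]
    exact Set.subset_sUnion_of_mem hA

/-- Every admissible family of `K` is the trace of an admissible family of `X ∪ K`. -/
theorem exists_covS_inr (h : Correlated ψ ∨ (T.IsSmall ∧ S.IsSmall)) {𝒱 : Set (Set K)}
    (h𝒱 : 𝒱 ∈ S.Cov) : ∃ 𝒲 ∈ covS ψ, (fun W => Sum.inr ⁻¹' W) '' 𝒲 = 𝒱 := by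
  suffices ∃ 𝒜 : Set T.closedLattice, (fun A : T.closedLattice => (A : Set X)ᶜ) '' 𝒜 ∈ T.Cov ∧
      (fun A => (remainder ψ A : Set K)ᶜ) '' 𝒜 = 𝒱 by
    obtain ⟨𝒜, h𝒜, rfl⟩ := this
    exact ⟨basicOpen ψ '' 𝒜, image_basicOpen_mem_covS h𝒜 h𝒱,
      by simp only [Set.image_image, inr_preimage_basicOpen]⟩
  rcases h with h | ⟨hT, hS⟩
  · obtain ⟨𝒰, h𝒰, rfl⟩ := (correlated_iff.1 h).subset h𝒱
    exact ⟨_, by rwa [image_compl_setOf (IsGenTopology.subset_open h𝒰)], rfl⟩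
  · obtain ⟨h𝒱o, 𝒱', h𝒱', hf, hun⟩ := hS.subset h𝒱
    have : Nonempty T.closedLattice := ⟨⟨∅, empty_mem_Cl⟩⟩
    have hc (V) : V ∈ 𝒱 → ∃ A : T.closedLattice, (remainder ψ A : Set K)ᶜ = V := fun hV => by
      obtain ⟨A, hA⟩ := remainder_surjective (ψ := ψ) ⟨Vᶜ, compl_mem_Cl.2 (h𝒱o hV)⟩
      exact ⟨A, by rw [hA, compl_compl]⟩
    choose! f hf' using hc
    obtain ⟨B, hB, hB'⟩ := exists_finite_inf (ψ := ψ) (hf.image f)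
    have hBV (V) (hV : V ∈ 𝒱) : (remainder ψ B : Set K) ⊆ remainder ψ (f V) := by
      rw [← Set.compl_subset_compl, hf' V hV, hB', Set.biUnion_image]
      refine (Set.subset_sUnion_of_mem hV).trans (hun.subset.trans ?_)
      rw [Set.sUnion_eq_biUnion]
      exact Set.iUnion₂_mono fun W hW => (hf' W (h𝒱' hW)).symm.subset
    have hfB (V) (hV : V ∈ 𝒱) : (remainder ψ (f V ⊔ B) : Set K)ᶜ = V := by
      rw [coe_remainder_sup, Set.union_eq_left.2 (hBV V hV), hf' V hV]
    -- The complements of the sets `f V` need not form an essentially finite family. Adjoining `B`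
    -- to each of them keeps the remainders and puts all complements inside the union of the
    -- finitely many with `V ∈ 𝒱'`.
    refine ⟨(fun V => f V ⊔ B) '' 𝒱, ?_, ?_⟩
    · rw [Set.image_image]
      refine image_mem_Cov_of_finite hT h𝒱' hf (fun V _ => (f V ⊔ B).2) fun V _ => ?_
      have hBsub : (B : Set X)ᶜ ⊆ ⋃ W ∈ 𝒱', ((f W ⊔ B : T.closedLattice) : Set X)ᶜ := by
        intro x hx
        have hx' := hB.subset hx
        rw [Set.biUnion_image] at hx'
        obtain ⟨W, hW, hxW⟩ := Set.mem_iUnion₂.1 hx'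
        exact Set.mem_iUnion₂.2 ⟨W, hW, fun h => h.elim hxW hx⟩
      exact (Set.compl_subset_compl.2 Set.subset_union_right).trans hBsub
    · rw [Set.image_image]
      exact (Set.image_congr hfB).trans (Set.image_id _)

end Remainder

end GTS

theorem theorem6p3 {X : Type u} {K : Type v} (T : GTS X) (S : GTS K)
    (hX : T.WeaklyNormal) (hnc : ¬ T.TopCompact) (hlc : T.TopLocallyCompact)
    (hK : S.WeaklyHausdorff) (hKc : S.TopCompact)
    (ψ : S.closedLattice ≃o T.LCl hlc)
    (h : GTS.Correlated ψ ∨ (T.IsSmall ∧ S.IsSmall)) :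
    ∃ α : GTS (X ⊕ K), α.Cov = GTS.covS ψ ∧ α.Op = GTS.opS ψ ∧
      α.WeaklyHausdorff ∧ T.IsStrictCompactification α Sum.inl ∧
      S.IsStrictSubspace α Sum.inr := by
  let α : GTS (X ⊕ K) := ⟨GTS.covS ψ, GTS.isGenTopology_covS⟩
  have hOp : α.Op = GTS.opS ψ := GTS.sUnion_covS
  have htop : α.top = GTS.topW ψ := by
    rw [GTS.top, hOp, GTS.generateFrom_opS]
  have hinl : imageOn Sum.inl T.Cov ⊆ traceOn α.Cov (Set.range (Sum.inl : X → X ⊕ K)) := by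
    rw [traceOn_range]
    exact imageOn_mono fun 𝒰 h𝒰 => GTS.exists_covS_inl h h𝒰
  have hinr : traceOn α.Cov (Set.range (Sum.inr : K → X ⊕ K)) = imageOn Sum.inr S.Cov := by
    rw [traceOn_range]
    apply subset_antisymm <;> apply imageOn_mono
    · rintro _ ⟨𝒲, h𝒲, rfl⟩
      exact h𝒲.2.2
    · exact fun 𝒱 h𝒱 => GTS.exists_covS_inr h h𝒱
  have hgen := (S.isGenTopology.imageOn (f := (Sum.inr : K → X ⊕ K))
    Sum.inr_injective).genTopologyGenerated_eq
  refine ⟨α, rfl, hOp, ?_, ⟨?_, ⟨⟨?_, Sum.inl_injective, ?_⟩, hinl⟩, ?_⟩,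
    Sum.inr_injective, ?_, ?_⟩
  · rw [GTS.WeaklyHausdorff, htop]
    exact GTS.t2Space_topW hX hK hKc
  · rw [GTS.TopCompact, htop]
    exact GTS.compactSpace_topW hKc
  · exact fun 𝒱 h𝒱 => h𝒱.2.1
  · exact fun 𝒲 h𝒲 _ _ hs => hs (hinl h𝒲)
  · rw [htop]
    exact GTS.dense_range_inl
  · rw [GTS.IsStrictSet, hinr, hgen]
  · rw [GTS.subspaceCov, hinr, hgen]
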